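/- Let $(W,H,\mu)$ be an abstract Wiener space with $\dim H=\infty$: $W$ is a separable real Banach space, $H$ (the Cameron–Martin space) is a real Hilbert space embedded in $W$ by a continuous linear injection $j$ with dense range, and $\mu$ is a Borel probability measure on $W$ under which every $\alpha\in W^*$ is a centered Gaussian random variable with variance $|\tilde\alpha|_H^2$, where $\tilde\alpha\in H$ is defined by $(\tilde\alpha,h)_H=\alpha(jh)$ for all $h\in H$. (For example, the classical Wiener space: $W=C_0([0,1])$, $\mu$ the Wiener measure, $H$ the space of absolutely continuous functions vanishing at $0$ with square integrable derivative.) Let $\delta:H\to L^2(\mu)$ be the continuous linear map with $\delta\tilde\alpha=\alpha$ for all $\alpha\in W^*$ (on the classical Wiener space, $\delta h=\int_0^1 h'(s)\,dw(s)$). Let $R$ be a unitary operator on $H$, let $(e_i)_{i\in\mathbb N}$ be a complete orthonormal basis of $H$, and let $T:W\to W$ be the corresponding rotation, i.e. a measurable map with $$Tw=\sum_{i=1}^\infty \delta(Re_i)(w)\,e_i\qquad\text{for } \mu\text{-almost every } w,$$ the series converging in $W$. A measure preserving transformation $S$ of a probability space $(\Omega,P)$ is ergodic if every measurable set $A$ with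 $S^{-1}A=A$ has probability $0$ or $1$, and mixing if $P(S^{-n}A\cap B)\to P(A)P(B)$ as $n\to\infty$ for all measurable $A,B$. A sequence $(\eta_n)_{n\in\mathbb Z}$ of real random variables is called ergodic (respectively mixing) if the shift $(x_n)_n\mapsto(x_{n+1})_n$ of $\mathbb R^{\mathbb Z}$ is measure preserving and ergodic (respectively mixing) for the law of $(\eta_n)_{n\in\mathbb Z}$. Then: 1. $T$ is measure preserving and ergodic if and only if, for every $h\in H$, the (stationary Gaussian) sequence $(\delta R^nh,\ n\in\mathbb Z)$ is ergodic. 2. $T$ is measure preserving and mixing if and only if, for every $h\in H$, the sequence $(\delta R^nh,\ n\in\mathbb Z)$ is mixing. -/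

import Mathlib

open MeasureTheory ProbabilityTheory Filter Topology
open scoped NNReal ENNReal

noncomputable section

namespace WienerRotation

/-! ## Abstract Wiener spaces -/

section Wiener

variable {W H : Type*} [NormedAddCommGroup W] [NormedSpace ℝ W]
  [NormedAddCommGroup H] [InnerProductSpace ℝ H] [CompleteSpace H]

/-- For a continuous linear map `j : H → W`, the transpose `W* → H* ≅ H`: the vector
`transpose j α` is the only one with `⟪transpose j α, h⟫ = α (j h)` for all `h`. -/
def transpose (j : H →L[ℝ] W) : StrongDual ℝ W →ₗ[ℝ] H where
  toFun α := (InnerProductSpace.toDual ℝ H).symm (α.comp j)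
  map_add' α β := by simp
  map_smul' c α := by simp

theorem inner_transpose (j : H →L[ℝ] W) (α : StrongDual ℝ W) (h : H) :
    inner ℝ (transpose j α) h = α (j h) := by
  simp [transpose]

theorem denseRange_transpose {j : H →L[ℝ] W} (hj : Function.Injective j) : DenseRange (transpose j) := by
  have h1 : (LinearMap.range (transpose j)).topologicalClosure = ⊤ := by
    rw [Submodule.topologicalClosure_eq_top_iff, Submodule.eq_bot_iff]
    intro h hh
    rw [Submodule.mem_orthogonal] at hh
    apply hj
    rw [map_zero]
    by_contra hne
    obtain ⟨α, -, hα⟩ := exists_dual_vector ℝ (j h) (norm_ne_zero_iff.2 hne)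
    have h2 := hh (transpose j α) ⟨α, rfl⟩
    rw [inner_transpose, hα] at h2
    exact hne (by simpa using h2)
  have h3 := (Submodule.dense_iff_topologicalClosure_eq_top).2 h1
  rwa [LinearMap.coe_range] at h3

variable [MeasurableSpace W]

/-- `(W, H, μ)` is an abstract Wiener space, where the Hilbert space `H` (the Cameron-Martin
space) sits densely in `W` through the injection `j`: under the measure `μ`, each continuous
linear functional `α` is a centered Gaussian variable of variance `‖transpose j α‖²`. -/
structure IsAbstractWienerSpace (j : H →L[ℝ] W) (μ : Measure W) : Prop where
  injective : Function.Injective j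
  denseRange : DenseRange j
  map_eq_gaussianReal : ∀ α : StrongDual ℝ W,
    μ.map α = gaussianReal 0 (‖transpose j α‖₊ ^ 2)

variable {j : H →L[ℝ] W} {μ : Measure W}

variable [BorelSpace W]

theorem IsAbstractWienerSpace.memLp (hμ : IsAbstractWienerSpace j μ) (α : StrongDual ℝ W) :
    MemLp α 2 μ := by
  have h : MemLp id 2 (μ.map α) := by
    rw [hμ.map_eq_gaussianReal α]
    exact memLp_id_gaussianReal 2
  exact (memLp_map_measure_iff (f := α) (by fun_prop) (by fun_prop)).1 h

/-- A continuous linear functional, as an element of `L²(μ)`. -/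
def dualToLp (hμ : IsAbstractWienerSpace j μ) : StrongDual ℝ W →ₗ[ℝ] Lp ℝ 2 μ where
  toFun α := (hμ.memLp α).toLp α
  map_add' α β := MemLp.toLp_add (hμ.memLp α) (hμ.memLp β)
  map_smul' c α := MemLp.toLp_const_smul c (hμ.memLp α)

theorem norm_dualToLp (hμ : IsAbstractWienerSpace j μ) (α : StrongDual ℝ W) :
    ‖dualToLp hμ α‖ = ‖transpose j α‖ := by
  have h1 : ‖dualToLp hμ α‖ ^ 2 = ∫ w, α w ^ 2 ∂μ := by
    rw [← real_inner_self_eq_norm_sq, L2.inner_def]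
    apply integral_congr_ae
    filter_upwards [(hμ.memLp α).coeFn_toLp] with w hw
    simp only [dualToLp, LinearMap.coe_mk, AddHom.coe_mk, hw]
    simp [sq]
  have h2 : ∫ w, α w ^ 2 ∂μ = ‖transpose j α‖ ^ 2 := by
    have h3 : ∫ x, x ^ 2 ∂(μ.map α) = ∫ w, α w ^ 2 ∂μ :=
      integral_map (by fun_prop) (by fun_prop)
    have h4 := variance_id_gaussianReal (μ := 0) (v := ‖transpose j α‖₊ ^ 2)
    rw [variance_eq_integral (by fun_prop)] at h4
    simp only [id, integral_id_gaussianReal, sub_zero] at h4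
    rw [← h3, hμ.map_eq_gaussianReal α, h4]
    simp
  exact (pow_left_inj₀ (norm_nonneg _) (norm_nonneg _) two_ne_zero).1 (h1.trans h2)

/-- The divergence `δ h` of a deterministic vector `h ∈ H`: the continuous linear extension to
`H` of the map that sends `transpose j α` to the random variable `α`. -/
def divergence (hμ : IsAbstractWienerSpace j μ) : H →L[ℝ] Lp ℝ 2 μ :=
  (dualToLp hμ).extendOfNorm (transpose j)

theorem divergence_transpose (hμ : IsAbstractWienerSpace j μ) (α : StrongDual ℝ W) :
    divergence hμ (transpose j α) = dualToLp hμ α :=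
  LinearMap.extendOfNorm_eq (denseRange_transpose hμ.injective)
    ⟨1, fun β => by rw [norm_dualToLp, one_mul]⟩ α

/-- `T` is (a version of) the rotation of `W` given by the unitary operator `R` of `H`:
`T w = ∑ i, δ (R (e i)) (w) • e i` almost surely, the series converging in `W`. -/
def IsRotation (hμ : IsAbstractWienerSpace j μ) (R : H ≃ₗᵢ[ℝ] H) (e : HilbertBasis ℕ ℝ H)
    (T : W → W) : Prop :=
  Measurable T ∧ ∀ᵐ w ∂μ, Tendsto
    (fun N : ℕ => ∑ i ∈ Finset.range N, (divergence hμ (R (e i)) : W → ℝ) w • j (e i))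
    atTop (𝓝 (T w))

end Wiener

/-! ## Mixing, and stationary sequences -/

/-- A measure preserving transformation `T` is mixing if `μ (T⁻ⁿ A ∩ B) → μ A * μ B` for all
events `A`, `B`. -/
structure IsMixing {Ω : Type*} [MeasurableSpace Ω] (T : Ω → Ω) (μ : Measure Ω) : Prop extends
    MeasurePreserving T μ μ where
  tendsto_inter : ∀ A B : Set Ω, MeasurableSet A → MeasurableSet B →
    Tendsto (fun n : ℕ => μ (T^[n] ⁻¹' A ∩ B)) atTop (𝓝 (μ A * μ B))

/-- The shift of two-sided real sequences. -/
def shift (x : ℤ → ℝ) : ℤ → ℝ := fun n => x (n + 1)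

/-- The law on `ℝ^ℤ` of a two-sided sequence of random variables. -/
def sequenceLaw {Ω : Type*} [MeasurableSpace Ω] (η : ℤ → Ω → ℝ) (μ : Measure Ω) :
    Measure (ℤ → ℝ) :=
  μ.map fun ω n => η n ω

/-- A sequence of random variables is ergodic if the shift is ergodic under its law. -/
def IsErgodicSequence {Ω : Type*} [MeasurableSpace Ω] (η : ℤ → Ω → ℝ) (μ : Measure Ω) : Prop :=
  Ergodic shift (sequenceLaw η μ)

/-- A sequence of random variables is mixing if the shift is mixing under its law. -/
def IsMixingSequence {Ω : Type*} [MeasurableSpace Ω] (η : ℤ → Ω → ℝ) (μ : Measure Ω) : Prop :=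
  IsMixing shift (sequenceLaw η μ)

end WienerRotation

end

/-!
Write `δ` for `divergence hμ`, and `α̃` for `transpose j α`.

The rotation `T` satisfies `δ h ∘ T = δ (R h)` almost surely: testing the defining series against a
functional `α` gives `α ∘ T = δ (R α̃)` (`IsRotation.dual_comp_ae_eq`), so that `T` preserves `μ` by
comparison of characteristic functions (`IsRotation.measurePreserving`), and the case of a general
`h` follows by density. Hence `w ↦ (δ (R ^ n h) w)_n` intertwines `T` and the shift
(`IsRotation.orbitMap_comp_ae_eq`), the shift under the law of the sequence is a factor of `T`, and
ergodicity and mixing pass from `T` to the sequences.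

For the converse, both properties are expressed by the decay of `⟪R ^ n h, k⟫` as `n → ∞`: along
`atTop` for mixing, and outside a set of integers of density zero, that is along the filter
`densityOne`, for ergodicity.
* The function `cos x₀` of the sequence `δ (R ^ n h)` has autocorrelations
  `exp (-‖h‖²) * cosh ⟪R ^ n h, h⟫`, and squared mean `exp (-‖h‖²)`. If the sequence is mixing, then
  `cosh ⟪R ^ n h, h⟫ - 1 → 0`. If it is ergodic, then this holds for the Cesàro means, by the mean
  ergodic theorem, and therefore along `densityOne` because `cosh t - 1 ≥ 0`. In both cases
  `⟪R ^ n h, h⟫ → 0`.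
* Then `⟪R ^ n h, k⟫ → 0` for every `k` (`tendsto_inner_pow_of_autocorrelation`).
* The functions `cos (α + c)`, for `α` in the dual of `W` and `c` real, are total in `L²(μ)`
  (`dense_span_cosLp`), and the correlation of `cos (α + c) ∘ T ^ n` and `cos (β + d)` is an
  explicit continuous function of `⟪R ^ n α̃, β̃⟫`. So all correlations of `T` decay along the filter
  (`IsRotation.tendsto_inner_koopman`), which gives mixing for `atTop`, and ergodicity for any
  nontrivial filter (`ergodic_of_tendsto_inner`).
-/

noncomputable section

namespace WienerRotation

/-! ### Sets of natural numbers of density one -/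

section DensityOne

open scoped Classical

/-- The filter of the sets of natural numbers whose complement has asymptotic density zero.
Convergence along it is convergence outside a set of density zero. -/
def densityOne : Filter ℕ where
  sets := {s | Tendsto (fun N : ℕ => (((Finset.range N).filter (· ∈ sᶜ)).card : ℝ) / N) atTop (𝓝 0)}
  univ_sets := by simp
  sets_of_superset {s t} hs hst := by
    refine squeeze_zero (fun N => by positivity) (fun N => ?_) hs
    gcongr
  inter_sets {s t} hs ht := by
    refine squeeze_zero (fun N => by positivity) (fun N => ?_) (by simpa using Tendsto.add hs ht)
    rw [← add_div]
    gcongr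
    rw [← Nat.cast_add, Nat.cast_le]
    refine (Finset.card_le_card ?_).trans (Finset.card_union_le _ _)
    intro n
    simp only [Finset.mem_filter, Finset.mem_union, Set.mem_compl_iff, Set.mem_inter_iff]
    tauto

theorem mem_densityOne {s : Set ℕ} : s ∈ densityOne ↔
    Tendsto (fun N : ℕ => (((Finset.range N).filter (· ∈ sᶜ)).card : ℝ) / N) atTop (𝓝 0) :=
  Iff.rfl

instance : densityOne.NeBot := by
  refine ⟨fun h => ?_⟩
  have h0 : (∅ : Set ℕ) ∈ densityOne := by rw [h]; exact mem_bot
  rw [mem_densityOne] at h0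
  have h1 : Tendsto (fun N : ℕ => (((Finset.range N).filter (· ∈ (∅ : Set ℕ)ᶜ)).card : ℝ) / N)
      atTop (𝓝 1) := by
    refine tendsto_const_nhds.congr' ?_
    filter_upwards [eventually_gt_atTop 0] with N hN
    have : (N : ℝ) ≠ 0 := by positivity
    simp [this]
  exact zero_ne_one (tendsto_nhds_unique h0 (by convert h1))

theorem densityOne_le_atTop : densityOne ≤ atTop := by
  refine fun s hs => ?_
  obtain ⟨m, hm⟩ := mem_atTop_sets.1 hs
  rw [mem_densityOne]
  refine squeeze_zero (fun N => by positivity) (fun N => ?_)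
    (tendsto_const_div_atTop_nhds_zero_nat (m : ℝ))
  gcongr
  calc _ ≤ (Finset.range m).card := Finset.card_le_card fun n hn => by
        simp only [Finset.mem_filter, Set.mem_compl_iff] at hn
        exact Finset.mem_range.2 (lt_of_not_ge fun h => hn.2 (hm n h))
    _ = m := Finset.card_range m

theorem tendsto_sub_densityOne (m : ℕ) : Tendsto (fun n => n - m) densityOne densityOne := by
  intro s hs
  rw [mem_densityOne] at hs
  rw [mem_map, mem_densityOne]
  refine squeeze_zero (fun N => by positivity) (fun N => ?_)
    (by simpa using hs.add (tendsto_const_div_atTop_nhds_zero_nat (m : ℝ)))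
  rw [← add_div]
  gcongr
  rw [← Nat.cast_add, Nat.cast_le]
  -- An exceptional `n < N` is either less than `m`, or `m + k` with `k < N` exceptional for `s`.
  calc _ ≤ (((Finset.range N).filter (· ∈ sᶜ)).image (· + m) ∪ Finset.range m).card := by
        refine Finset.card_le_card fun n hn => ?_
        simp only [Finset.mem_filter, Finset.mem_range, Set.mem_compl_iff, Set.mem_preimage] at hn
        simp only [Finset.mem_union, Finset.mem_image, Finset.mem_filter, Finset.mem_range,
          Set.mem_compl_iff]
        rcases lt_or_ge n m with h | h
        · exact Or.inr h
        · exact Or.inl ⟨n - m, ⟨by omega, hn.2⟩, by omega⟩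
    _ ≤ _ := (Finset.card_union_le _ _).trans
        (add_le_add Finset.card_image_le (Finset.card_range m).le)

/-- A nonnegative sequence whose Cesàro means tend to zero, tends to zero outside a set of density
zero. This is Markov's inequality for the uniform measure on `{0, …, N - 1}`. -/
theorem tendsto_densityOne_of_cesaro {u : ℕ → ℝ} (hu : ∀ n, 0 ≤ u n)
    (h : Tendsto (fun N : ℕ => (N : ℝ)⁻¹ * ∑ n ∈ Finset.range N, u n) atTop (𝓝 0)) :
    Tendsto u densityOne (𝓝 0) := by
  rw [Metric.tendsto_nhds]
  intro ε hε
  change {n | dist (u n) 0 < ε} ∈ densityOne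
  rw [mem_densityOne]
  refine squeeze_zero (fun N => by positivity) (fun N => ?_)
    (by simpa using h.const_mul ε⁻¹)
  rw [div_eq_inv_mul, mul_left_comm]
  gcongr
  rw [inv_mul_eq_div, le_div_iff₀ hε]
  calc _ ≤ ∑ n ∈ (Finset.range N).filter (· ∈ {n | dist (u n) 0 < ε}ᶜ), u n := by
        rw [← nsmul_eq_mul]
        refine Finset.card_nsmul_le_sum _ _ _ fun n hn => ?_
        simpa [abs_of_nonneg (hu n)] using (Finset.mem_filter.1 hn).2
    _ ≤ _ := Finset.sum_le_sum_of_subset_of_nonneg (Finset.filter_subset _ _)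
        fun n _ _ => hu n

end DensityOne

/-! ### Correlations in a Hilbert space -/

section Hilbert

variable {E : Type*} [NormedAddCommGroup E] [InnerProductSpace ℝ E] {l : Filter ℕ}

theorem tendsto_zero_of_dense_span {B : ℕ → E →L[ℝ] ℝ} {C : ℝ} (hC : ∀ n, ‖B n‖ ≤ C) {S : Set E}
    (hS : (Submodule.span ℝ S).topologicalClosure = ⊤)
    (h : ∀ x ∈ S, Tendsto (fun n => B n x) l (𝓝 0)) (x : E) :
    Tendsto (fun n => B n x) l (𝓝 0) := by
  have hspan : ∀ y ∈ Submodule.span ℝ S, Tendsto (fun n => B n y) l (𝓝 0) := by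
    intro y hy
    induction hy using Submodule.span_induction with
    | mem y hy => exact h y hy
    | zero => simpa using tendsto_const_nhds
    | add y z _ _ hy hz => simpa using hy.add hz
    | smul c y _ hy => simpa using hy.const_mul c
  have hx : x ∈ closure (Submodule.span ℝ S : Set E) := by
    rw [← Submodule.topologicalClosure_coe, hS]; trivial
  have hC0 : 0 ≤ C := (norm_nonneg _).trans (hC 0)
  rw [Metric.tendsto_nhds]
  intro ε hε
  obtain ⟨y, hy, hxy⟩ := Metric.mem_closure_iff.1 hx (ε / 2 / (C + 1)) (by positivity)
  filter_upwards [Metric.tendsto_nhds.1 (hspan y hy) (ε / 2) (half_pos hε)] with n hn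
  rw [dist_zero_right] at hn ⊢
  have h1 : ‖B n (x - y)‖ ≤ ε / 2 := by
    rw [dist_eq_norm] at hxy
    calc ‖B n (x - y)‖ ≤ (C + 1) * ‖x - y‖ :=
          (B n).le_of_opNorm_le ((hC n).trans (by linarith)) _
      _ ≤ (C + 1) * (ε / 2 / (C + 1)) := by gcongr
      _ = ε / 2 := by field_simp
  calc ‖B n x‖ = ‖B n (x - y) + B n y‖ := by rw [← map_add, sub_add_cancel]
    _ ≤ ‖B n (x - y)‖ + ‖B n y‖ := norm_add_le _ _
    _ < ε := by linarith

/-- The decay of correlations `⟪U ^ n F, G⟫ → ⟪v, F⟫ * ⟪v, G⟫` extends from a total set to the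
whole space. -/
theorem tendsto_inner_pow_of_dense_span (U : E →ₗᵢ[ℝ] E) (v : E) {S : Set E}
    (hS : (Submodule.span ℝ S).topologicalClosure = ⊤)
    (h : ∀ F ∈ S, ∀ G ∈ S, Tendsto (fun n => inner ℝ ((U ^ n) F) G) l
      (𝓝 (inner ℝ v F * inner ℝ v G))) (F G : E) :
    Tendsto (fun n => inner ℝ ((U ^ n) F) G) l (𝓝 (inner ℝ v F * inner ℝ v G)) := by
  have right : ∀ F ∈ S, ∀ G, Tendsto (fun n => inner ℝ ((U ^ n) F) G) l
      (𝓝 (inner ℝ v F * inner ℝ v G)) := by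
    intro F hF G
    have := tendsto_zero_of_dense_span (l := l)
      (B := fun n => innerSL ℝ ((U ^ n) F) - inner ℝ v F • innerSL ℝ v)
      (C := ‖F‖ + ‖inner ℝ v F • innerSL ℝ v‖) (fun n => by
        refine (norm_sub_le _ _).trans (le_of_eq ?_)
        rw [innerSL_apply_norm, LinearIsometry.norm_map]) hS
      (fun G hG => by simpa using (h F hF G hG).sub_const (inner ℝ v F * inner ℝ v G)) G
    simpa using this.add_const (inner ℝ v F * inner ℝ v G)
  have := tendsto_zero_of_dense_span (l := l)
    (B := fun n => (innerSL ℝ G).comp (U ^ n).toContinuousLinearMap - inner ℝ v G • innerSL ℝ v)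
    (C := ‖innerSL ℝ G‖ + ‖inner ℝ v G • innerSL ℝ v‖) (fun n => by
      refine (norm_sub_le _ _).trans (add_le_add_left ?_ _)
      refine (ContinuousLinearMap.opNorm_comp_le _ _).trans ?_
      exact mul_le_of_le_one_right (norm_nonneg _) (LinearIsometry.norm_toContinuousLinearMap_le _))
    hS (fun F hF => by
      simpa [real_inner_comm G, mul_comm] using
        (right F hF G).sub_const (inner ℝ v F * inner ℝ v G)) F
  simpa [real_inner_comm G, mul_comm] using this.add_const (inner ℝ v F * inner ℝ v G)

/-- If the autocorrelations of `h` under an isometry `U` tend to zero, then so do the correlations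
of the orbit of `h` with each `k`. Indeed, this holds for the vectors `k` of the orbit, and for
those orthogonal to it. -/
theorem tendsto_inner_pow_of_autocorrelation [CompleteSpace E] (U : E →ₗᵢ[ℝ] E) (h : E)
    (hl : l ≤ atTop) (hsub : ∀ m, Tendsto (fun n => n - m) l l)
    (hh : Tendsto (fun n => inner ℝ ((U ^ n) h) h) l (𝓝 0)) (k : E) :
    Tendsto (fun n => inner ℝ ((U ^ n) h) k) l (𝓝 0) := by
  set M := (Submodule.span ℝ (Set.range fun m : ℕ => (U ^ m) h)).topologicalClosure with hM
  have hmem : ∀ n, (U ^ n) h ∈ M := fun n =>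
    Submodule.le_topologicalClosure _ (Submodule.subset_span ⟨n, rfl⟩)
  have : CompleteSpace M := (Submodule.isClosed_topologicalClosure _).completeSpace_coe
  refine tendsto_zero_of_dense_span (B := fun n => innerSL ℝ ((U ^ n) h)) (C := ‖h‖)
    (S := (Set.range fun m : ℕ => (U ^ m) h) ∪ Mᗮ) (fun n => by
      rw [innerSL_apply_norm, LinearIsometry.norm_map]) ?_ ?_ k
  -- The two parts of the set span `M` densely, and `Mᗮ`.
  · rw [Submodule.span_union, Submodule.span_eq, eq_top_iff,
      ← Submodule.sup_orthogonal_of_hasOrthogonalProjection (K := M)]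
    refine sup_le ?_ ?_
    · exact Submodule.topologicalClosure_mono le_sup_left
    · exact le_sup_right.trans (Submodule.le_topologicalClosure _)
  · rintro x (⟨m, rfl⟩ | hx)
    -- For `n ≥ m`, the correlation of `U ^ n h` with `U ^ m h` is that of `U ^ (n - m) h` with `h`.
    · refine (hh.comp (hsub m)).congr' ?_
      filter_upwards [hl (eventually_ge_atTop m)] with n hn
      obtain ⟨d, rfl⟩ := Nat.exists_eq_add_of_le hn
      simp only [Function.comp_apply, innerSL_apply_apply, add_tsub_cancel_left, pow_add]
      exact ((U ^ m).inner_map_map _ _).symm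
    · refine tendsto_const_nhds.congr fun n => ?_
      rw [innerSL_apply_apply]
      exact ((Submodule.mem_orthogonal _ _).1 hx _ (hmem n)).symm

end Hilbert

/-! ### Ergodicity and mixing in terms of correlations -/

section Correlations

variable {Ω : Type*} [MeasurableSpace Ω] {ν : Measure Ω} {S : Ω → Ω}

/-- The Koopman operator `F ↦ F ∘ S` of a measure preserving transformation, on `L²(ν)`. -/
def koopman (hS : MeasurePreserving S ν ν) : Lp ℝ 2 ν →ₗᵢ[ℝ] Lp ℝ 2 ν :=
  Lp.compMeasurePreservingₗᵢ ℝ S hS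

theorem koopman_ae_eq (hS : MeasurePreserving S ν ν) (F : Lp ℝ 2 ν) :
    koopman hS F =ᵐ[ν] F ∘ S :=
  Lp.coeFn_compMeasurePreserving F hS

theorem koopman_pow_apply (hS : MeasurePreserving S ν ν) (n : ℕ) (F : Lp ℝ 2 ν) :
    (koopman hS ^ n) F = Lp.compMeasurePreserving S^[n] (hS.iterate n) F := by
  rw [LinearIsometry.coe_pow, ← Lp.compMeasurePreserving_iterate]
  rfl

theorem inner_toLp {f g : Ω → ℝ} (hf : MemLp f 2 ν) (hg : MemLp g 2 ν) :
    inner ℝ (hf.toLp f) (hg.toLp g) = ∫ x, f x * g x ∂ν := by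
  rw [L2.inner_def]
  refine integral_congr_ae ?_
  filter_upwards [hf.coeFn_toLp, hg.coeFn_toLp] with x hx hy
  simp [hx, hy, mul_comm]

theorem inner_koopman_pow_toLp (hS : MeasurePreserving S ν ν) (n : ℕ) {f g : Ω → ℝ}
    (hf : MemLp f 2 ν) (hg : MemLp g 2 ν) :
    inner ℝ ((koopman hS ^ n) (hf.toLp f)) (hg.toLp g) = ∫ x, f (S^[n] x) * g x ∂ν := by
  rw [koopman_pow_apply, Lp.toLp_compMeasurePreserving, inner_toLp]
  rfl

/-- The constant function `1`, in `L²(ν)`. -/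
def oneLp (ν : Measure Ω) [IsFiniteMeasure ν] : Lp ℝ 2 ν := Lp.const 2 ν 1

variable [IsFiniteMeasure ν]

theorem inner_oneLp_toLp {f : Ω → ℝ} (hf : MemLp f 2 ν) :
    inner ℝ (oneLp ν) (hf.toLp f) = ∫ x, f x ∂ν := by
  have h : oneLp ν = (memLp_const (1 : ℝ)).toLp (fun _ => 1) := rfl
  rw [h, inner_toLp]
  simp

theorem memLp_indicator_one {A : Set Ω} (hA : MeasurableSet A) :
    MemLp (A.indicator fun _ => (1 : ℝ)) 2 ν :=
  (memLp_const 1).indicator hA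

/-- The indicator function of a measurable set, in `L²(ν)`. -/
def indicatorLp (ν : Measure Ω) [IsFiniteMeasure ν] {A : Set Ω} (hA : MeasurableSet A) :
    Lp ℝ 2 ν :=
  (memLp_indicator_one hA).toLp _

theorem inner_koopman_pow_indicator (hS : MeasurePreserving S ν ν) (n : ℕ) {A B : Set Ω}
    (hA : MeasurableSet A) (hB : MeasurableSet B) :
    inner ℝ ((koopman hS ^ n) (indicatorLp ν hA)) (indicatorLp ν hB)
      = ν.real (S^[n] ⁻¹' A ∩ B) := by
  rw [indicatorLp, indicatorLp, inner_koopman_pow_toLp, ← integral_indicator_one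
    (((hS.iterate n).measurable hA).inter hB)]
  refine integral_congr_ae (Eventually.of_forall fun x => ?_)
  by_cases h1 : S^[n] x ∈ A <;> by_cases h2 : x ∈ B <;> simp [h1, h2]

theorem inner_oneLp_indicator {A : Set Ω} (hA : MeasurableSet A) :
    inner ℝ (oneLp ν) (indicatorLp ν hA) = ν.real A := by
  rw [indicatorLp, inner_oneLp_toLp]
  exact integral_indicator_one hA

/-- The indicator functions are total in `L²(ν)`. -/
theorem dense_span_indicator : (Submodule.span ℝ {F : Lp ℝ 2 ν | ∃ (A : Set Ω)
    (hA : MeasurableSet A), F = indicatorLp ν hA}).topologicalClosure = ⊤ := by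
  rw [eq_top_iff]
  intro F _
  refine Lp.induction (p := 2) (by finiteness) (· ∈ (Submodule.span ℝ {F : Lp ℝ 2 ν |
    ∃ (A : Set Ω) (hA : MeasurableSet A), F = indicatorLp ν hA}).topologicalClosure)
    (fun c s hs hμs => ?_) (fun f g hf hg _ h1 h2 => Submodule.add_mem _ h1 h2)
    (Submodule.isClosed_topologicalClosure _) F
  have h : (↑(Lp.simpleFunc.indicatorConst 2 hs hμs.ne c) : Lp ℝ 2 ν) = c • indicatorLp ν hs := by
    rw [Lp.simpleFunc.coe_indicatorConst, indicatorLp, ← MemLp.toLp_const_smul, indicatorConstLp]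
    congr 1
    ext x
    by_cases hx : x ∈ s <;> simp [hx]
  rw [h]
  exact Submodule.le_topologicalClosure _
    (Submodule.smul_mem _ _ (Submodule.subset_span ⟨s, hs, rfl⟩))

theorem IsMixing.tendsto_inner (h : IsMixing S ν) (F G : Lp ℝ 2 ν) :
    Tendsto (fun n => inner ℝ ((koopman h.toMeasurePreserving ^ n) F) G) atTop
      (𝓝 (inner ℝ (oneLp ν) F * inner ℝ (oneLp ν) G)) := by
  refine tendsto_inner_pow_of_dense_span _ _ dense_span_indicator ?_ F G
  rintro _ ⟨A, hA, rfl⟩ _ ⟨B, hB, rfl⟩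
  simp only [inner_koopman_pow_indicator, inner_oneLp_indicator, Measure.real, ← ENNReal.toReal_mul]
  exact (ENNReal.tendsto_toReal (by finiteness)).comp (h.tendsto_inter A B hA hB)

theorem isMixing_of_tendsto_inner (hS : MeasurePreserving S ν ν)
    (h : ∀ F G : Lp ℝ 2 ν, Tendsto (fun n => inner ℝ ((koopman hS ^ n) F) G) atTop
      (𝓝 (inner ℝ (oneLp ν) F * inner ℝ (oneLp ν) G))) : IsMixing S ν := by
  refine ⟨hS, fun A B hA hB => ?_⟩
  have := h (indicatorLp ν hA) (indicatorLp ν hB)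
  simp only [inner_koopman_pow_indicator, inner_oneLp_indicator, Measure.real,
    ← ENNReal.toReal_mul] at this
  exact (ENNReal.tendsto_toReal_iff (fun _ => by finiteness) (by finiteness)).1 this

/-- Decay of correlations along any nontrivial filter implies ergodicity: an invariant set `A`
satisfies `ν A = ν A * ν A`. -/
theorem ergodic_of_tendsto_inner [IsProbabilityMeasure ν] {l : Filter ℕ} [l.NeBot]
    (hS : MeasurePreserving S ν ν)
    (h : ∀ F G : Lp ℝ 2 ν, Tendsto (fun n => inner ℝ ((koopman hS ^ n) F) G) l
      (𝓝 (inner ℝ (oneLp ν) F * inner ℝ (oneLp ν) G))) : Ergodic S ν := by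
  refine ⟨hS, ⟨fun A hA hinv => ?_⟩⟩
  have h1 := h (indicatorLp ν hA) (indicatorLp ν hA)
  have hn : ∀ n, S^[n] ⁻¹' A = A := fun n => by
    rw [Set.preimage_iterate_eq]
    exact Function.iterate_fixed hinv n
  simp only [inner_koopman_pow_indicator, inner_oneLp_indicator, hn, Set.inter_self] at h1
  have h2 : ν.real A = ν.real A * ν.real A := tendsto_nhds_unique tendsto_const_nhds h1
  refine eventuallyConst_set.2 ?_
  rcases mul_left_eq_self₀.1 h2.symm with h3 | h3
  · exact Or.inl (mem_ae_iff_prob_eq_one hA |>.2 ((ENNReal.toReal_eq_one_iff _).1 h3))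
  · exact Or.inr (measure_eq_zero_iff_ae_notMem.1 ((measureReal_eq_zero_iff (by finiteness)).1 h3))

/-- For an ergodic transformation, correlations decay on average. By the mean ergodic theorem
the averages converge to the projection onto the invariant functions, which are constant. -/
theorem tendsto_cesaro_inner_of_ergodic [IsProbabilityMeasure ν] (h : Ergodic S ν)
    (F G : Lp ℝ 2 ν) :
    Tendsto (fun N : ℕ => (N : ℝ)⁻¹ * ∑ n ∈ Finset.range N,
      inner ℝ ((koopman h.toMeasurePreserving ^ n) F) G) atTop
      (𝓝 (inner ℝ (oneLp ν) F * inner ℝ (oneLp ν) G)) := by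
  set U := koopman h.toMeasurePreserving
  have h1 := U.toContinuousLinearMap.tendsto_birkhoffAverage_orthogonalProjection
    U.norm_toContinuousLinearMap_le F
  set P := ((U.toContinuousLinearMap.eqLocus
    (1 : Lp ℝ 2 ν →L[ℝ] Lp ℝ 2 ν)).orthogonalProjectionOnto F : Lp ℝ 2 ν) with hP
  have hPmem : U P = P :=
    Subtype.property (((U.toContinuousLinearMap).eqLocus
    (1 : Lp ℝ 2 ν →L[ℝ] Lp ℝ 2 ν)).orthogonalProjectionOnto F)
  -- Composition with `S` leaves constants unchanged.
  have hone : oneLp ν ∈ U.toContinuousLinearMap.eqLocus (1 : Lp ℝ 2 ν →L[ℝ] Lp ℝ 2 ν) := by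
    rfl
  obtain ⟨c, hc⟩ : ∃ c : ℝ, P = c • oneLp ν := by
    obtain ⟨c, hc⟩ := h.ae_eq_const_of_ae_eq_comp_ae (Lp.aestronglyMeasurable P)
      ((koopman_ae_eq h.toMeasurePreserving P).symm.trans (by rw [hPmem]))
    refine ⟨c, Lp.ext ?_⟩
    filter_upwards [hc, Lp.coeFn_smul c (oneLp ν), Lp.coeFn_const (p := 2) (μ := ν) (1 : ℝ)]
      with x h1 h2 h3
    rw [h1, h2, Pi.smul_apply, oneLp, h3]
    simp
  have hinner : inner ℝ (oneLp ν) F = c := by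
    have h2 : inner ℝ (oneLp ν) (F - P) = 0 := by
      exact Submodule.inner_right_of_mem_orthogonal hone
        (Submodule.sub_starProjection_mem_orthogonal F)
    have h3 : inner ℝ (oneLp ν) (oneLp ν) = (1 : ℝ) := by
      refine (inner_oneLp_toLp (memLp_const (1 : ℝ))).trans ?_
      simp
    rw [inner_sub_right, hc, inner_smul_right, h3] at h2
    linarith
  have h4 := ((innerSL ℝ G).continuous.tendsto _).comp h1
  rw [hc] at h4
  rw [hinner]
  simpa [Function.comp_def, birkhoffAverage, birkhoffSum, inner_sum, inner_smul_right,
    LinearIsometry.coe_pow, real_inner_comm G] using h4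

end Correlations

/-! ### Factors -/

section Factors

variable {Ω Ω' : Type*} [MeasurableSpace Ω] {μ : Measure Ω} {T : Ω → Ω} {S : Ω' → Ω'} {Φ : Ω → Ω'}

theorem iterate_semiconj_ae (hT : MeasurePreserving T μ μ) (h : Φ ∘ T =ᵐ[μ] S ∘ Φ) (n : ℕ) :
    Φ ∘ T^[n] =ᵐ[μ] S^[n] ∘ Φ := by
  induction n with
  | zero => rfl
  | succ n ih =>
    have h1 := hT.quasiMeasurePreserving.ae ih
    filter_upwards [h1, h] with x hx1 hx2
    simp only [Function.comp_apply, Function.iterate_succ_apply] at *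
    rw [hx1, hx2]

variable [MeasurableSpace Ω']

theorem measurePreserving_map_of_semiconj (hT : MeasurePreserving T μ μ) (hS : Measurable S)
    (hΦ : Measurable Φ) (h : Φ ∘ T =ᵐ[μ] S ∘ Φ) : MeasurePreserving S (μ.map Φ) (μ.map Φ) := by
  refine ⟨hS, ?_⟩
  rw [Measure.map_map hS hΦ, ← Measure.map_congr h, ← Measure.map_map hΦ hT.measurable, hT.map_eq]

/-- A factor of an ergodic transformation is ergodic, also if the factor map intertwines the two
transformations only almost everywhere. -/
theorem ergodic_map_of_semiconj (hT : Ergodic T μ) (hS : Measurable S) (hΦ : Measurable Φ)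
    (h : Φ ∘ T =ᵐ[μ] S ∘ Φ) : Ergodic S (μ.map Φ) := by
  refine ⟨measurePreserving_map_of_semiconj hT.toMeasurePreserving hS hΦ h, ⟨fun A hA hinv => ?_⟩⟩
  have h1 : T ⁻¹' (Φ ⁻¹' A) =ᵐ[μ] Φ ⁻¹' A := by
    filter_upwards [h] with x hx
    have : Φ (T x) = S (Φ x) := hx
    apply propext
    change Φ (T x) ∈ A ↔ Φ x ∈ A
    rw [this, ← Set.mem_preimage, hinv]
  rcases hT.quasiErgodic.ae_mem_or_ae_notMem₀ (hΦ hA).nullMeasurableSet h1 with h2 | h2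
  · exact eventuallyConst_set.2 (Or.inl ((ae_map_iff hΦ.aemeasurable hA).2 h2))
  · exact eventuallyConst_set.2 (Or.inr ((ae_map_iff hΦ.aemeasurable hA.compl).2 h2))

theorem isMixing_map_of_semiconj (hT : IsMixing T μ) (hS : Measurable S) (hΦ : Measurable Φ)
    (h : Φ ∘ T =ᵐ[μ] S ∘ Φ) : IsMixing S (μ.map Φ) := by
  refine ⟨measurePreserving_map_of_semiconj hT.toMeasurePreserving hS hΦ h, fun A B hA hB => ?_⟩
  rw [Measure.map_apply hΦ hA, Measure.map_apply hΦ hB]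
  refine (hT.tendsto_inter _ _ (hΦ hA) (hΦ hB)).congr fun n => ?_
  rw [Measure.map_apply hΦ (((hS.iterate n) hA).inter hB)]
  refine measure_congr ?_
  filter_upwards [iterate_semiconj_ae hT.toMeasurePreserving h n] with x hx
  have : Φ (T^[n] x) = S^[n] (Φ x) := hx
  apply propext
  change Φ (T^[n] x) ∈ A ∧ Φ x ∈ B ↔ S^[n] (Φ x) ∈ A ∧ Φ x ∈ B
  rw [this]

end Factors

/-! ### Trigonometric functions on a Banach space -/

section Trigonometric

variable {W : Type*} [NormedAddCommGroup W] [NormedSpace ℝ W] [MeasurableSpace W] [BorelSpace W]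

theorem integrable_cos {Ω : Type*} [MeasurableSpace Ω] {μ : Measure Ω} [IsFiniteMeasure μ]
    {X : Ω → ℝ} (hX : AEMeasurable X μ) (c : ℝ) : Integrable (fun w => Real.cos (X w + c)) μ :=
  Integrable.of_bound (by fun_prop) 1
    (Eventually.of_forall fun w => by simpa using Real.abs_cos_le_one _)

theorem memLp_cos {Ω : Type*} [MeasurableSpace Ω] {μ : Measure Ω} [IsFiniteMeasure μ]
    {X : Ω → ℝ} (hX : AEMeasurable X μ) (c : ℝ) : MemLp (fun w => Real.cos (X w + c)) 2 μ :=
  MemLp.of_bound (by fun_prop) 1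
    (Eventually.of_forall fun w => by simpa using Real.abs_cos_le_one _)

theorem charFunDual_eq_integral_cos (μ : Measure W) [IsFiniteMeasure μ] (α : StrongDual ℝ W) :
    charFunDual μ α = (∫ w, Real.cos (α w + 0) ∂μ : ℝ) +
      (∫ w, Real.cos (α w + -(Real.pi / 2)) ∂μ : ℝ) * Complex.I := by
  have hα : AEMeasurable α μ := by fun_prop
  rw [charFunDual_apply, ← integral_complex_ofReal, ← integral_complex_ofReal,
    ← integral_mul_const, ← integral_add (integrable_cos hα _).ofReal
      ((integrable_cos hα _).ofReal.mul_const _)]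
  refine integral_congr_ae (Eventually.of_forall fun w => ?_)
  simp only [add_zero, ← sub_eq_add_neg, Real.cos_sub_pi_div_two]
  rw [Complex.exp_mul_I, Complex.ofReal_cos, Complex.ofReal_sin]

/-- The functions `cos (α + c)` separate the finite measures, as their integrals give the
characteristic function. -/
theorem ext_of_integral_cos [CompleteSpace W] [SecondCountableTopology W] {μ ν : Measure W}
    [IsFiniteMeasure μ] [IsFiniteMeasure ν]
    (h : ∀ (α : StrongDual ℝ W) (c : ℝ),
      ∫ w, Real.cos (α w + c) ∂μ = ∫ w, Real.cos (α w + c) ∂ν) : μ = ν :=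
  Measure.ext_of_charFunDual <| funext fun α => by
    rw [charFunDual_eq_integral_cos, charFunDual_eq_integral_cos, h, h]

/-- The function `cos (α + c)`, in `L²(μ)`. The phase `c` makes the family contain both the cosines
and the sines. -/
def cosLp (μ : Measure W) [IsFiniteMeasure μ] (α : StrongDual ℝ W) (c : ℝ) : Lp ℝ 2 μ :=
  (memLp_cos (X := α) (by fun_prop) c).toLp _

theorem integral_withDensity_ofReal {Ω : Type*} [MeasurableSpace Ω] {μ : Measure Ω} {f : Ω → ℝ}
    (hf : Measurable f) (g : Ω → ℝ) :
    ∫ w, g w ∂(μ.withDensity fun w => ENNReal.ofReal (f w)) = ∫ w, max (f w) 0 * g w ∂μ := by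
  rw [integral_withDensity_eq_integral_toReal_smul (by fun_prop) (by simp)]
  simp [ENNReal.toReal_ofReal']

/-- The functions `cos (α + c)` are total in `L²(μ)`. If `G` is orthogonal to all of them, they do
not distinguish the measures of densities `G⁺` and `G⁻`, so these are equal. -/
theorem dense_span_cosLp [CompleteSpace W] [SecondCountableTopology W] (μ : Measure W)
    [IsFiniteMeasure μ] :
    (Submodule.span ℝ (Set.range fun p : StrongDual ℝ W × ℝ =>
      cosLp μ p.1 p.2)).topologicalClosure = ⊤ := by
  rw [Submodule.topologicalClosure_eq_top_iff, Submodule.eq_bot_iff]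
  intro G hG
  have hGm : Measurable G := (Lp.stronglyMeasurable G).measurable
  have hGi : Integrable G μ := (Lp.memLp G).integrable (by norm_num)
  have hzero : ∀ (α : StrongDual ℝ W) (c : ℝ), ∫ w, G w * Real.cos (α w + c) ∂μ = 0 := by
    intro α c
    have h1 := (Submodule.mem_orthogonal' _ _).1 hG (cosLp μ α c)
      (Submodule.subset_span ⟨(α, c), rfl⟩)
    rw [← Lp.toLp_coeFn G (Lp.memLp G)] at h1
    exact (inner_toLp _ _).symm.trans h1
  have : IsFiniteMeasure (μ.withDensity fun w => ENNReal.ofReal (G w)) :=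
    isFiniteMeasure_withDensity_ofReal hGi.2
  have : IsFiniteMeasure (μ.withDensity fun w => ENNReal.ofReal (-G w)) :=
    isFiniteMeasure_withDensity_ofReal hGi.neg.2
  have heq : (μ.withDensity fun w => ENNReal.ofReal (G w)) =
      μ.withDensity fun w => ENNReal.ofReal (-G w) := by
    refine ext_of_integral_cos fun α c => ?_
    rw [integral_withDensity_ofReal hGm,
      integral_withDensity_ofReal (f := fun w => -G w) hGm.neg, ← sub_eq_zero, ← integral_sub]
    · refine (integral_congr_ae (Eventually.of_forall fun w => ?_)).trans (hzero α c)
      change max (G w) 0 * _ - max (-G w) 0 * _ = _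
      rw [← sub_mul]
      congr 1
      rcases le_total (G w) 0 with h | h
      · rw [max_eq_right h, max_eq_left (by linarith)]; ring
      · rw [max_eq_left h, max_eq_right (by linarith)]; ring
    · exact hGi.pos_part.mul_bdd (c := 1) (integrable_cos (by fun_prop) c).aestronglyMeasurable
        (Eventually.of_forall fun w => by simpa using Real.abs_cos_le_one _)
    · exact hGi.neg.pos_part.mul_bdd (c := 1) (integrable_cos (by fun_prop) c).aestronglyMeasurable
        (Eventually.of_forall fun w => by simpa using Real.abs_cos_le_one _)
  rw [withDensity_eq_iff_of_sigmaFinite (by fun_prop) (by fun_prop)] at heq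
  rw [Lp.eq_zero_iff_ae_eq_zero]
  filter_upwards [heq] with w hw
  rcases le_total (G w) 0 with h | h
  · rw [ENNReal.ofReal_of_nonpos h, eq_comm, ENNReal.ofReal_eq_zero] at hw
    exact le_antisymm h (neg_nonpos.1 hw)
  · rw [ENNReal.ofReal_of_nonpos (neg_nonpos.2 h), ENNReal.ofReal_eq_zero] at hw
    exact le_antisymm hw h

end Trigonometric

/-! ### Trigonometric moments of the divergence -/

section Divergence

variable {W H : Type*} [NormedAddCommGroup W] [NormedSpace ℝ W] [MeasurableSpace W] [BorelSpace W]
  [NormedAddCommGroup H] [InnerProductSpace ℝ H] [CompleteSpace H]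
  {j : H →L[ℝ] W} {μ : Measure W}

theorem measurable_divergence (hμ : IsAbstractWienerSpace j μ) (h : H) :
    Measurable (divergence hμ h : W → ℝ) :=
  (Lp.stronglyMeasurable _).measurable

theorem divergence_transpose_ae_eq (hμ : IsAbstractWienerSpace j μ) (α : StrongDual ℝ W) :
    (divergence hμ (transpose j α) : W → ℝ) =ᵐ[μ] α := by
  rw [divergence_transpose]
  exact (hμ.memLp α).coeFn_toLp

theorem integral_cos_dual [IsFiniteMeasure μ] (hμ : IsAbstractWienerSpace j μ)
    (α : StrongDual ℝ W) (c : ℝ) :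
    ∫ w, Real.cos (α w + c) ∂μ = Real.cos c * Real.exp (-‖transpose j α‖ ^ 2 / 2) := by
  have hα : AEMeasurable α μ := by fun_prop
  have h1 : charFun (μ.map α) 1 = ∫ w, Complex.exp (α w * Complex.I) ∂μ := by
    rw [charFun_apply_real, integral_map hα (by fun_prop)]
    simp
  rw [hμ.map_eq_gaussianReal α, charFun_gaussianReal] at h1
  have hint : Integrable (fun w => Complex.exp (α w * Complex.I)) μ :=
    Integrable.of_bound (by fun_prop) 1 (Eventually.of_forall fun w => by
      rw [Complex.norm_exp_ofReal_mul_I])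
  have h2 : ∀ w, Real.cos (α w + c) =
      (Complex.exp (c * Complex.I) * Complex.exp (α w * Complex.I)).re := by
    intro w
    rw [← Complex.exp_add, ← add_mul, ← Complex.ofReal_add, Complex.exp_ofReal_mul_I_re, add_comm]
  simp_rw [h2]
  have h3 := integral_re (hint.const_mul (Complex.exp (c * Complex.I)))
  simp only [RCLike.re_eq_complex_re] at h3
  rw [h3, integral_const_mul, ← h1]
  have h4 : Complex.exp (((1 : ℝ) : ℂ) * ((0 : ℝ) : ℂ) * Complex.I
      - ((‖transpose j α‖₊ ^ 2 : ℝ≥0) : ℂ) * ((1 : ℝ) : ℂ) ^ 2 / 2)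
      = (Real.exp (-‖transpose j α‖ ^ 2 / 2) : ℝ) := by
    push_cast
    congr 1
    simp
    ring
  rw [h4, Complex.re_mul_ofReal, Complex.exp_ofReal_mul_I_re]

/-- The variable `δ u` is centered Gaussian of variance `‖u‖ ^ 2`, in the form of the trigonometric
moments that determine its characteristic function. -/
theorem integral_cos_divergence [IsFiniteMeasure μ] (hμ : IsAbstractWienerSpace j μ)
    (u : H) (c : ℝ) :
    ∫ w, Real.cos ((divergence hμ u : W → ℝ) w + c) ∂μ =
      Real.cos c * Real.exp (-‖u‖ ^ 2 / 2) := by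
  -- `compLp` needs a Lipschitz function that vanishes at `0`.
  have hlip : LipschitzWith 1 fun x : ℝ => Real.cos (x + c) - Real.cos c := by
    refine LipschitzWith.of_dist_le_mul fun x y => ?_
    rw [Real.dist_eq, Real.dist_eq, NNReal.coe_one, one_mul, sub_sub_sub_cancel_right]
    simpa using Real.abs_cos_sub_cos_le (x + c) (y + c)
  have hcont : Continuous fun u : H =>
      inner ℝ (oneLp μ) (hlip.compLp (by simp) (divergence hμ u)) +
        μ.real Set.univ * Real.cos c := by
    have := (hlip.continuous_compLp (p := 2) (μ := μ) (by simp)).comp (divergence hμ).continuous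
    exact (continuous_const.inner this).add_const _
  have heq : ∀ u : H, ∫ w, Real.cos ((divergence hμ u : W → ℝ) w + c) ∂μ =
      inner ℝ (oneLp μ) (hlip.compLp (by simp) (divergence hμ u)) +
        μ.real Set.univ * Real.cos c := by
    intro u
    rw [← Lp.toLp_coeFn (hlip.compLp _ (divergence hμ u)) (Lp.memLp _), inner_oneLp_toLp,
      integral_congr_ae (hlip.coeFn_compLp (by simp) (divergence hμ u))]
    simp only [Function.comp_apply]
    rw [integral_sub (integrable_cos (measurable_divergence hμ u).aemeasurable c)
      (integrable_const _)]
    simp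
  have hext := DenseRange.equalizer (denseRange_transpose hμ.injective) hcont
    (by fun_prop : Continuous fun u : H => Real.cos c * Real.exp (-‖u‖ ^ 2 / 2))
    (funext fun α => by
      simp only [Function.comp_apply]
      rw [← heq, ← integral_cos_dual hμ]
      refine integral_congr_ae ?_
      filter_upwards [divergence_transpose_ae_eq hμ α] with w hw
      rw [hw])
  rw [heq]
  exact congrFun hext u

theorem integral_cos_mul_cos_divergence [IsFiniteMeasure μ] (hμ : IsAbstractWienerSpace j μ)
    (u v : H) (c d : ℝ) :
    ∫ w, Real.cos ((divergence hμ u : W → ℝ) w + c) * Real.cos ((divergence hμ v : W → ℝ) w + d) ∂μ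
      = Real.exp (-‖u‖ ^ 2 / 2) * Real.exp (-‖v‖ ^ 2 / 2) *
        (Real.cos (c + d) * Real.exp (-inner ℝ u v) + Real.cos (c - d) * Real.exp (inner ℝ u v))
          / 2 := by
  have h1 : ∫ w, Real.cos ((divergence hμ u : W → ℝ) w + c) *
      Real.cos ((divergence hμ v : W → ℝ) w + d) ∂μ =
      ∫ w, (Real.cos ((divergence hμ (u + v) : W → ℝ) w + (c + d)) +
        Real.cos ((divergence hμ (u - v) : W → ℝ) w + (c - d))) / 2 ∂μ := by
    refine integral_congr_ae ?_
    rw [map_add, map_sub]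
    filter_upwards [Lp.coeFn_add (divergence hμ u) (divergence hμ v),
      Lp.coeFn_sub (divergence hμ u) (divergence hμ v)] with w hw1 hw2
    rw [hw1, hw2, Pi.add_apply, Pi.sub_apply]
    set x := (divergence hμ u : W → ℝ) w
    set y := (divergence hμ v : W → ℝ) w
    rw [show x + y + (c + d) = (x + c) + (y + d) by ring,
      show x - y + (c - d) = (x + c) - (y + d) by ring, Real.cos_add (x + c), Real.cos_sub (x + c)]
    ring
  rw [h1, integral_div, integral_add
    (integrable_cos (measurable_divergence hμ _).aemeasurable _)
    (integrable_cos (measurable_divergence hμ _).aemeasurable _),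
    integral_cos_divergence, integral_cos_divergence, norm_add_sq_real, norm_sub_sq_real,
    show -(‖u‖ ^ 2 + 2 * inner ℝ u v + ‖v‖ ^ 2) / 2 =
      -‖u‖ ^ 2 / 2 + -‖v‖ ^ 2 / 2 + -inner ℝ u v by ring,
    show -(‖u‖ ^ 2 - 2 * inner ℝ u v + ‖v‖ ^ 2) / 2 =
      -‖u‖ ^ 2 / 2 + -‖v‖ ^ 2 / 2 + inner ℝ u v by ring,
    Real.exp_add _ (-inner ℝ u v), Real.exp_add _ (inner ℝ u v), Real.exp_add]
  ring

end Divergence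

/-! ### Rotations -/

section Rotation

variable {W H : Type*} [NormedAddCommGroup W] [NormedSpace ℝ W] [MeasurableSpace W] [BorelSpace W]
  [NormedAddCommGroup H] [InnerProductSpace ℝ H] [CompleteSpace H]
  {j : H →L[ℝ] W} {μ : Measure W}

theorem coeFn_sum_range_smul {Ω : Type*} [MeasurableSpace Ω] {μ : Measure Ω} (a : ℕ → ℝ)
    (F : ℕ → Lp ℝ 2 μ) (N : ℕ) :
    (∑ i ∈ Finset.range N, a i • F i : Lp ℝ 2 μ) =ᵐ[μ]
      fun w => ∑ i ∈ Finset.range N, a i * F i w := by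
  induction N with
  | zero =>
    simp only [Finset.range_zero, Finset.sum_empty]
    exact Lp.coeFn_zero ℝ 2 μ
  | succ N ih =>
    simp only [Finset.sum_range_succ]
    filter_upwards [ih, Lp.coeFn_add (∑ i ∈ Finset.range N, a i • F i) (a N • F N),
      Lp.coeFn_smul (a N) (F N)] with w h1 h2 h3
    rw [h2, Pi.add_apply, h1, h3, Pi.smul_apply, smul_eq_mul]

/-- The series that defines the rotation is tested against a functional `α`: it becomes the
expansion of `δ (R α̃)`, which converges in `L²(μ)`. -/
theorem IsRotation.dual_comp_ae_eq [IsFiniteMeasure μ] {hμ : IsAbstractWienerSpace j μ}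
    {R : H ≃ₗᵢ[ℝ] H} {e : HilbertBasis ℕ ℝ H} {T : W → W} (hT : IsRotation hμ R e T)
    (α : StrongDual ℝ W) :
    (fun w => α (T w)) =ᵐ[μ] (divergence hμ (R (transpose j α)) : W → ℝ) := by
  have hcoef : ∀ i, e.repr (transpose j α) i = α (j (e i)) := fun i => by
    rw [HilbertBasis.repr_apply_apply, real_inner_comm, inner_transpose]
  have h1 : Tendsto (fun N => ∑ i ∈ Finset.range N, α (j (e i)) • divergence hμ (R (e i))) atTop
      (𝓝 (divergence hμ (R (transpose j α)))) := by
    have h2 := ((e.hasSum_repr (transpose j α)).mapL R.toContinuousLinearEquiv.toContinuousLinearMap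
      |>.mapL (divergence hμ)).tendsto_sum_nat
    simpa [hcoef] using h2
  refine tendstoInMeasure_ae_unique (u := atTop) (f := fun N : ℕ =>
    (∑ i ∈ Finset.range N, α (j (e i)) • divergence hμ (R (e i)) : Lp ℝ 2 μ)) ?_
    (tendstoInMeasure_of_tendsto_Lp h1)
  refine tendstoInMeasure_of_tendsto_ae (fun N => Lp.aestronglyMeasurable _) ?_
  filter_upwards [hT.2, ae_all_iff.2
    (coeFn_sum_range_smul (fun i => α (j (e i))) fun i => divergence hμ (R (e i)))] with w hw hN
  simp_rw [hN]
  refine ((α.continuous.tendsto _).comp hw).congr fun N => ?_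
  simp [mul_comm]

variable [CompleteSpace W] [SecondCountableTopology W] [IsFiniteMeasure μ]
  {hμ : IsAbstractWienerSpace j μ} {R : H ≃ₗᵢ[ℝ] H} {e : HilbertBasis ℕ ℝ H} {T : W → W}

/-- A rotation preserves the measure, since `α ∘ T = δ (R α̃)` has the law of `α`. -/
theorem IsRotation.measurePreserving (hT : IsRotation hμ R e T) : MeasurePreserving T μ μ := by
  refine ⟨hT.1, ext_of_integral_cos fun α c => ?_⟩
  rw [integral_map hT.1.aemeasurable (by fun_prop), integral_cos_dual hμ,
    ← R.norm_map, ← integral_cos_divergence hμ]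
  refine integral_congr_ae ?_
  filter_upwards [hT.dual_comp_ae_eq α] with w hw
  rw [hw]

theorem IsRotation.koopman_divergence (hT : IsRotation hμ R e T) (h : H) :
    koopman hT.measurePreserving (divergence hμ h) = divergence hμ (R h) := by
  refine congrFun (DenseRange.equalizer (denseRange_transpose hμ.injective)
    ((koopman hT.measurePreserving).continuous.comp (divergence hμ).continuous)
    ((divergence hμ).continuous.comp R.continuous) (funext fun α => Lp.ext ?_)) h
  refine (koopman_ae_eq _ _).trans ?_
  refine EventuallyEq.trans ?_ (hT.dual_comp_ae_eq α)
  exact hT.measurePreserving.quasiMeasurePreserving.ae_eq_comp (divergence_transpose_ae_eq hμ α)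

theorem IsRotation.divergence_comp_ae_eq (hT : IsRotation hμ R e T) (h : H) :
    (divergence hμ h : W → ℝ) ∘ T =ᵐ[μ] (divergence hμ (R h) : W → ℝ) := by
  rw [← hT.koopman_divergence]
  exact (koopman_ae_eq _ _).symm

theorem IsRotation.dual_iterate_ae_eq (hT : IsRotation hμ R e T) (α : StrongDual ℝ W) (n : ℕ) :
    (fun w => α (T^[n] w)) =ᵐ[μ] (divergence hμ (R^[n] (transpose j α)) : W → ℝ) := by
  have h : ∀ h : H, (divergence hμ h : W → ℝ) ∘ T^[n] =ᵐ[μ] (divergence hμ (R^[n] h) : W → ℝ) := by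
    induction n with
    | zero => exact fun h => ae_eq_refl _
    | succ n ih =>
      intro h
      rw [Function.iterate_succ, ← Function.comp_assoc, Function.iterate_succ_apply']
      refine EventuallyEq.trans ?_ (hT.divergence_comp_ae_eq _)
      exact hT.measurePreserving.quasiMeasurePreserving.ae_eq_comp (ih h)
  refine EventuallyEq.trans ?_ (h _)
  exact (hT.measurePreserving.iterate n).quasiMeasurePreserving.ae_eq_comp
    (divergence_transpose_ae_eq hμ α).symm

/-- If the matrix coefficients of `R` tend to zero, then the correlations of the rotation decay. -/
theorem IsRotation.tendsto_inner_koopman (hT : IsRotation hμ R e T) {l : Filter ℕ}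
    (hR : ∀ h k : H, Tendsto (fun n => inner ℝ (R^[n] h) k) l (𝓝 0)) (F G : Lp ℝ 2 μ) :
    Tendsto (fun n => inner ℝ ((koopman hT.measurePreserving ^ n) F) G) l
      (𝓝 (inner ℝ (oneLp μ) F * inner ℝ (oneLp μ) G)) := by
  refine tendsto_inner_pow_of_dense_span _ _ (dense_span_cosLp μ) ?_ F G
  rintro _ ⟨⟨α, c⟩, rfl⟩ _ ⟨⟨β, d⟩, rfl⟩
  have h1 : ∀ n, inner ℝ ((koopman hT.measurePreserving ^ n) (cosLp μ α c)) (cosLp μ β d) =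
      Real.exp (-‖transpose j α‖ ^ 2 / 2) * Real.exp (-‖transpose j β‖ ^ 2 / 2) *
        (Real.cos (c + d) * Real.exp (-inner ℝ (R^[n] (transpose j α)) (transpose j β)) +
          Real.cos (c - d) * Real.exp (inner ℝ (R^[n] (transpose j α)) (transpose j β))) / 2 := by
    intro n
    have hnorm : ‖R^[n] (transpose j α)‖ = ‖transpose j α‖ := by
      rw [← LinearIsometryEquiv.coe_toLinearIsometry, ← LinearIsometry.coe_pow,
        LinearIsometry.norm_map]
    rw [cosLp, cosLp, inner_koopman_pow_toLp, ← hnorm, ← integral_cos_mul_cos_divergence hμ]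
    refine integral_congr_ae ?_
    filter_upwards [hT.dual_iterate_ae_eq α n, divergence_transpose_ae_eq hμ β] with w h1 h2
    rw [h1, h2]
  simp only [h1]
  rw [cosLp, cosLp, inner_oneLp_toLp, inner_oneLp_toLp, integral_cos_dual hμ, integral_cos_dual hμ]
  have h2 := hR (transpose j α) (transpose j β)
  have h3 := ((((Real.continuous_exp.tendsto _).comp h2.neg).const_mul (Real.cos (c + d))).add
    (((Real.continuous_exp.tendsto _).comp h2).const_mul (Real.cos (c - d)))).const_mul
      (Real.exp (-‖transpose j α‖ ^ 2 / 2) * Real.exp (-‖transpose j β‖ ^ 2 / 2)) |>.div_const 2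
  refine h3.congr' (Eventually.of_forall fun n => rfl) |>.trans (le_of_eq ?_)
  congr 1
  rw [neg_zero, Real.exp_zero, Real.cos_add, Real.cos_sub]
  ring

end Rotation

/-! ### The Gaussian sequences of a rotation -/

section Sequence

variable {W H : Type*} [NormedAddCommGroup W] [NormedSpace ℝ W] [MeasurableSpace W] [BorelSpace W]
  [NormedAddCommGroup H] [InnerProductSpace ℝ H] [CompleteSpace H]
  {j : H →L[ℝ] W} {μ : Measure W}

/-- The two-sided sequence `δ (R ^ n h)`, as a map from `W` to the space of real sequences. -/
def orbitMap (hμ : IsAbstractWienerSpace j μ) (R : H ≃ₗᵢ[ℝ] H) (h : H) (w : W) : ℤ → ℝ :=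
  fun n => (divergence hμ ((R ^ n) h) : W → ℝ) w

theorem measurable_orbitMap (hμ : IsAbstractWienerSpace j μ) (R : H ≃ₗᵢ[ℝ] H) (h : H) :
    Measurable (orbitMap hμ R h) :=
  measurable_pi_lambda _ fun _ => measurable_divergence hμ _

theorem measurable_shift : Measurable shift :=
  measurable_pi_lambda _ fun _ => measurable_pi_apply _

theorem iterate_shift_apply (n : ℕ) (x : ℤ → ℝ) (m : ℤ) : shift^[n] x m = x (m + n) := by
  induction n generalizing m with
  | zero => simp
  | succ n ih =>
    rw [Function.iterate_succ_apply', shift, ih]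
    congr 1
    push_cast
    ring

/-- This uses `t ^ 2 ≤ 2 * (cosh t - 1)`, where `cosh t - 1 = 2 * sinh (t / 2) ^ 2`. -/
theorem tendsto_zero_of_tendsto_cosh {l : Filter ℕ} {t : ℕ → ℝ}
    (h : Tendsto (fun n => Real.cosh (t n) - 1) l (𝓝 0)) : Tendsto t l (𝓝 0) := by
  have h1 : ∀ n, t n ^ 2 ≤ 2 * (Real.cosh (t n) - 1) := fun n => by
    have h2 : |t n / 2| ≤ |Real.sinh (t n / 2)| := by
      rw [Real.abs_sinh]
      exact Real.self_le_sinh_iff.2 (abs_nonneg _)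
    have h3 := Real.cosh_two_mul (t n / 2)
    rw [mul_div_cancel₀ (t n) two_ne_zero, Real.cosh_sq] at h3
    nlinarith [sq_le_sq.2 h2]
  have h2 : Tendsto (fun n => t n ^ 2) l (𝓝 0) :=
    squeeze_zero (fun n => sq_nonneg _) h1 (by simpa using h.const_mul 2)
  have h3 := (Real.continuous_sqrt.tendsto _).comp h2
  rw [Real.sqrt_zero] at h3
  refine (tendsto_zero_iff_abs_tendsto_zero _).2 (h3.congr fun n => ?_)
  exact Real.sqrt_sq_eq_abs _

variable [IsProbabilityMeasure μ] (hμ : IsAbstractWienerSpace j μ) (R : H ≃ₗᵢ[ℝ] H) (h : H)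

/-- The function `cos x₀` on the space of sequences, in `L²` of the law of `δ (R ^ n h)`. -/
def cosZeroLp : Lp ℝ 2 (μ.map (orbitMap hμ R h)) :=
  (memLp_cos (X := fun x : ℤ → ℝ => x 0) (measurable_pi_apply 0).aemeasurable 0).toLp _

theorem inner_oneLp_cosZeroLp :
    inner ℝ (oneLp _) (cosZeroLp hμ R h) = Real.exp (-‖h‖ ^ 2 / 2) := by
  have := integral_cos_divergence hμ h 0
  rw [Real.cos_zero, one_mul] at this
  have hm : Measurable fun x : ℤ → ℝ => Real.cos (x 0 + 0) := by fun_prop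
  rw [cosZeroLp, inner_oneLp_toLp, integral_map (measurable_orbitMap hμ R h).aemeasurable
    hm.aestronglyMeasurable, ← this]
  simp [orbitMap]

/-- The autocorrelations of `cos x₀` under the shift, which control those of `h` under `R`. -/
theorem inner_koopman_cosZeroLp
    (hS : MeasurePreserving shift (μ.map (orbitMap hμ R h)) (μ.map (orbitMap hμ R h))) (n : ℕ) :
    inner ℝ ((koopman hS ^ n) (cosZeroLp hμ R h)) (cosZeroLp hμ R h) =
      Real.exp (-‖h‖ ^ 2 / 2) * Real.exp (-‖h‖ ^ 2 / 2) *
        Real.cosh (inner ℝ ((R.toLinearIsometry ^ n) h) h) := by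
  have hpow : (R ^ (n : ℤ)) h = (R.toLinearIsometry ^ n) h := by
    rw [zpow_natCast, LinearIsometry.coe_pow]
    exact congrFun (hom_coe_pow (fun f : H ≃ₗᵢ[ℝ] H => ⇑f) rfl (fun _ _ => rfl) R n) h
  have := integral_cos_mul_cos_divergence hμ ((R ^ (n : ℤ)) h) h 0 0
  rw [(R ^ (n : ℤ)).norm_map] at this
  have hm : Measurable fun x : ℤ → ℝ => Real.cos (shift^[n] x 0 + 0) * Real.cos (x 0 + 0) := by
    simp only [iterate_shift_apply]
    fun_prop
  rw [cosZeroLp, inner_koopman_pow_toLp, integral_map (measurable_orbitMap hμ R h).aemeasurable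
    hm.aestronglyMeasurable, ← hpow, Real.cosh_eq]
  simp only [iterate_shift_apply, orbitMap, zero_add, zpow_zero, LinearIsometryEquiv.coe_one, id]
  rw [this]
  simp
  ring

theorem tendsto_autocorrelation_of_isMixing (hm : IsMixing shift (μ.map (orbitMap hμ R h))) :
    Tendsto (fun n => inner ℝ ((R.toLinearIsometry ^ n) h) h) atTop (𝓝 0) := by
  have h1 := hm.tendsto_inner (cosZeroLp hμ R h) (cosZeroLp hμ R h)
  simp only [inner_koopman_cosZeroLp, inner_oneLp_cosZeroLp] at h1
  refine tendsto_zero_of_tendsto_cosh ?_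
  have h2 := (h1.const_mul (Real.exp (-‖h‖ ^ 2 / 2) * Real.exp (-‖h‖ ^ 2 / 2))⁻¹).sub_const 1
  have h3 : Real.exp (-‖h‖ ^ 2 / 2) * Real.exp (-‖h‖ ^ 2 / 2) ≠ 0 := by positivity
  simpa only [inv_mul_cancel_left₀ h3, inv_mul_cancel₀ h3, sub_self] using h2

theorem tendsto_autocorrelation_of_ergodic (he : Ergodic shift (μ.map (orbitMap hμ R h))) :
    Tendsto (fun n => inner ℝ ((R.toLinearIsometry ^ n) h) h) densityOne (𝓝 0) := by
  have := Measure.isProbabilityMeasure_map (μ := μ) (measurable_orbitMap hμ R h).aemeasurable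
  have h1 := tendsto_cesaro_inner_of_ergodic he (cosZeroLp hμ R h) (cosZeroLp hμ R h)
  simp only [inner_koopman_cosZeroLp, inner_oneLp_cosZeroLp] at h1
  refine tendsto_zero_of_tendsto_cosh (tendsto_densityOne_of_cesaro
    (fun n => sub_nonneg.2 (Real.one_le_cosh _)) ?_)
  have h2 := (h1.const_mul (Real.exp (-‖h‖ ^ 2 / 2) * Real.exp (-‖h‖ ^ 2 / 2))⁻¹).sub_const 1
  have h3 : Real.exp (-‖h‖ ^ 2 / 2) * Real.exp (-‖h‖ ^ 2 / 2) ≠ 0 := by positivity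
  rw [inv_mul_cancel₀ h3, sub_self] at h2
  refine h2.congr' ?_
  filter_upwards [eventually_gt_atTop 0] with N hN
  have hN' : (N : ℝ) ≠ 0 := by positivity
  rw [← Finset.mul_sum, Finset.sum_sub_distrib, mul_left_comm, inv_mul_cancel_left₀ h3]
  simp [mul_sub, hN']

end Sequence

section RotationSequence

variable {W H : Type*} [NormedAddCommGroup W] [NormedSpace ℝ W] [MeasurableSpace W] [BorelSpace W]
  [CompleteSpace W] [SecondCountableTopology W]
  [NormedAddCommGroup H] [InnerProductSpace ℝ H] [CompleteSpace H]
  {j : H →L[ℝ] W} {μ : Measure W} [IsFiniteMeasure μ]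
  {hμ : IsAbstractWienerSpace j μ} {R : H ≃ₗᵢ[ℝ] H} {e : HilbertBasis ℕ ℝ H} {T : W → W}

theorem IsRotation.orbitMap_comp_ae_eq (hT : IsRotation hμ R e T) (h : H) :
    orbitMap hμ R h ∘ T =ᵐ[μ] shift ∘ orbitMap hμ R h := by
  filter_upwards [ae_all_iff.2 fun n : ℤ => hT.divergence_comp_ae_eq ((R ^ n) h)] with w hw
  funext n
  refine (hw n).trans ?_
  simp only [Function.comp_apply, shift, orbitMap]
  rw [add_comm n 1, zpow_one_add]
  rfl

end RotationSequence

end WienerRotation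

end

theorem corollary3 {W H : Type*} [NormedAddCommGroup W] [NormedSpace ℝ W] [CompleteSpace W]
    [SecondCountableTopology W] [MeasurableSpace W] [BorelSpace W]
    [NormedAddCommGroup H] [InnerProductSpace ℝ H] [CompleteSpace H]
    (j : H →L[ℝ] W) (μ : Measure W) [IsProbabilityMeasure μ]
    (hμ : WienerRotation.IsAbstractWienerSpace j μ)
    (R : H ≃ₗᵢ[ℝ] H) (e : HilbertBasis ℕ ℝ H) (T : W → W)
    (hT : WienerRotation.IsRotation hμ R e T) :
    (Ergodic T μ ↔ ∀ h : H, WienerRotation.IsErgodicSequence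
      (fun (n : ℤ) (w : W) => (WienerRotation.divergence hμ ((R ^ n) h) : W → ℝ) w) μ) ∧
    (WienerRotation.IsMixing T μ ↔ ∀ h : H, WienerRotation.IsMixingSequence
      (fun (n : ℤ) (w : W) => (WienerRotation.divergence hμ ((R ^ n) h) : W → ℝ) w) μ) := by
  open WienerRotation in
  have hR : ∀ (l : Filter ℕ), l ≤ atTop → (∀ m, Tendsto (fun n => n - m) l l) →
      (∀ h, Tendsto (fun n => inner ℝ ((R.toLinearIsometry ^ n) h) h) l (𝓝 0)) →
      ∀ h k, Tendsto (fun n => inner ℝ (R^[n] h) k) l (𝓝 0) := by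
    intro l hl hsub hauto h k
    simpa only [LinearIsometry.coe_pow, LinearIsometryEquiv.coe_toLinearIsometry] using
      tendsto_inner_pow_of_autocorrelation R.toLinearIsometry h hl hsub (hauto h) k
  refine ⟨⟨fun hE h => ?_, fun hE => ?_⟩, ⟨fun hM h => ?_, fun hM => ?_⟩⟩
  · exact ergodic_map_of_semiconj hE measurable_shift (measurable_orbitMap hμ R h)
      (hT.orbitMap_comp_ae_eq h)
  · exact ergodic_of_tendsto_inner hT.measurePreserving (hT.tendsto_inner_koopman
      (hR densityOne densityOne_le_atTop tendsto_sub_densityOne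
        fun h => tendsto_autocorrelation_of_ergodic hμ R h (hE h)))
  · exact isMixing_map_of_semiconj hM measurable_shift (measurable_orbitMap hμ R h)
      (hT.orbitMap_comp_ae_eq h)
  · exact isMixing_of_tendsto_inner hT.measurePreserving (hT.tendsto_inner_koopman
      (hR atTop le_rfl tendsto_sub_atTop_nat
        fun h => tendsto_autocorrelation_of_isMixing hμ R h (hM h)))
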